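/- Let $\mathscr{A}$ be a (not necessarily unital) complex $^*$-algebra. A linear functional $f:\mathscr{A}\to\mathbb{C}$ is called representable if there are a $^*$-representation $\pi$ of $\mathscr{A}$ by bounded operators on a Hilbert space $H$ and a vector $\zeta\in H$ with $f(a)=\langle\pi(a)\zeta,\zeta\rangle$ for all $a\in\mathscr{A}$. Let $\mathscr{A}^\sharp$ be the set of representable functionals. For linear functionals write $f\le g$ if $(g-f)(a^*a)\ge 0$ for all $a\in\mathscr{A}$, and for $f\in\mathscr{A}^\sharp$ let $[0,f]=\{h\in\mathscr{A}^\sharp : 0\le h\le f\}$. Functionals $f,g$ are singular, $f\perp g$, if the only $h\in\mathscr{A}^\sharp$ with $h\le f$ and $h\le g$ is $h=0$. For $f,g\in\mathscr{A}^\sharp$ with GNS triples $(H_f,\pi_f,\zeta_f)$ and $(H_g,\pi_g,\zeta_g)$ the parallel sum $f:g\in\mathscr{A}^\sharp$ is $$(f:g)(a)=\langle(\pi_f\oplus\pi_g)(a)P(\zeta_f\oplus 0),P(\zeta_f\oplus 0)\rangle,\qquad a\in\mathscr{A},$$ where $P$ is the orthogonal projection of $H_f\oplus H_g$ onto the orthogonal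 complement of $\{\pi_f(a)\zeta_f\oplus\pi_g(a)\zeta_g : a\in\mathscr{A}\}$. Let $[g]f:=\sup_{n\in\mathbb{N}} f:(ng)$ be the least upper bound in $(\mathscr{A}^\sharp,\le)$. **Theorem.** Let $f,g\in\mathscr{A}^\sharp$ with $g\le f$. Then the least upper bound $[g]f$ exists, and the following statements are equivalent: (i) $g$ is an extreme point of $[0,f]$; (ii) $g$ is a disjoint part of $f$, that is, $g\le f$ and $g\perp f-g$; (iii) $[g]f=g$. -/

import Mathlib

open scoped InnerProductSpace

universe u

/-- A linear functional `f` on a `*`-algebra is positive if `f (a* a) ≥ 0` for all `a`. -/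
def IsPositiveFunctional {A : Type u} [NonUnitalRing A] [StarRing A] [Module ℂ A]
    (f : A →ₗ[ℂ] ℂ) : Prop :=
  ∀ a : A, 0 ≤ (f (star a * a)).re ∧ (f (star a * a)).im = 0

/-- The ordering induced by positivity: `f ≤ g` means that `g - f` is positive. -/
def FunctionalLE {A : Type u} [NonUnitalRing A] [StarRing A] [Module ℂ A]
    (f g : A →ₗ[ℂ] ℂ) : Prop :=
  IsPositiveFunctional (g - f)

/-- `f` is representable if `f a = ⟨π(a) ζ, ζ⟩` for a `*`-representation `π` of `A` by bounded
operators of a Hilbert space and a vector `ζ`. (Mathlib's inner product is linear in its second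
argument. The universe of `H` is no restriction: one may always replace `H` by the closure
of `π(A) ζ`, which is a completion of a quotient of `A`.) -/
def IsRepresentable {A : Type u} [NonUnitalRing A] [StarRing A] [Module ℂ A]
    (f : A →ₗ[ℂ] ℂ) : Prop :=
  ∃ (H : Type u) (_ : NormedAddCommGroup H) (_ : InnerProductSpace ℂ H) (_ : CompleteSpace H)
    (π : A →⋆ₙₐ[ℂ] (H →L[ℂ] H)) (ζ : H), ∀ a : A, f a = ⟪ζ, π a ζ⟫_ℂ

/-- The set of representable functionals on `A`. -/
structure RepresentableFunctional (A : Type u) [NonUnitalRing A] [StarRing A] [Module ℂ A] where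
  toLin : A →ₗ[ℂ] ℂ
  representable : IsRepresentable toLin

namespace RepresentableFunctional

section Basic

variable {A : Type u} [NonUnitalRing A] [StarRing A] [Module ℂ A]

instance instPreorder : Preorder (RepresentableFunctional A) where
  le f g := FunctionalLE f.toLin g.toLin
  le_refl f a := by simp
  le_trans f g h hfg hgh a := by
    have h1 := hfg a
    have h2 := hgh a
    simp only [LinearMap.sub_apply, Complex.sub_re, Complex.sub_im] at h1 h2 ⊢
    exact ⟨by linarith [h1.1, h2.1], by linarith [h1.2, h2.2]⟩

instance instZero : Zero (RepresentableFunctional A) where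
  zero := ⟨0, PUnit, inferInstance, inferInstance, inferInstance, 0, 0, fun a => by simp⟩

/-- The multiple `n g` of a representable functional by a natural number. -/
noncomputable instance instSMulNat : SMul ℕ (RepresentableFunctional A) where
  smul n g := ⟨(n : ℂ) • g.toLin, by
    obtain ⟨H, i1, i2, i3, π, ζ, h⟩ := g.representable
    refine ⟨H, i1, i2, i3, π, ((Real.sqrt n : ℝ) : ℂ) • ζ, fun a => ?_⟩
    have hs : ((Real.sqrt n : ℝ) : ℂ) * ((Real.sqrt n : ℝ) : ℂ) = (n : ℂ) := by
      rw [← Complex.ofReal_mul, Real.mul_self_sqrt (Nat.cast_nonneg n), Complex.ofReal_natCast]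
    rw [map_smul, inner_smul_left, inner_smul_right, Complex.conj_ofReal, ← mul_assoc, hs, ← h a]
    rfl⟩

/-- The order interval `[f, g]` of representable functionals, as a set of linear functionals. -/
def interval (f g : RepresentableFunctional A) : Set (A →ₗ[ℂ] ℂ) :=
  toLin '' Set.Icc f g

/-- Two functionals are (mutually) singular if the only representable functional
below both of them is zero. -/
def Singular (f g : A →ₗ[ℂ] ℂ) : Prop :=
  ∀ h : RepresentableFunctional A, FunctionalLE h.toLin f → FunctionalLE h.toLin g → h.toLin = 0

/-- `g` is a disjoint part of `f` if `g ≤ f`, and `g` and `f - g` are mutually singular. -/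
def IsDisjointPart (g f : RepresentableFunctional A) : Prop :=
  g ≤ f ∧ Singular g.toLin (f.toLin - g.toLin)

/-- Values of a represented functional on products `x* y`. -/
lemma apply_star_mul {f : A →ₗ[ℂ] ℂ} {H : Type*} [NormedAddCommGroup H] [InnerProductSpace ℂ H]
    [CompleteSpace H] {π : A →⋆ₙₐ[ℂ] (H →L[ℂ] H)} {ζ : H} (h : ∀ a : A, f a = ⟪ζ, π a ζ⟫_ℂ)
    (x y : A) : f (star x * y) = ⟪π x ζ, π y ζ⟫_ℂ := by
  rw [h, map_mul, map_star, mul_apply_eq_comp, ContinuousLinearMap.star_eq_adjoint,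
    ContinuousLinearMap.adjoint_inner_right]

end Basic

section GNS

variable {A : Type u} [NonUnitalRing A] [StarRing A] [Module ℂ A] [IsScalarTower ℂ A A]
  [SMulCommClass ℂ A A] [StarModule ℂ A]

set_option linter.unusedVariables false in
/-- The algebra `A` itself, to be equipped with the semi-inner product induced by `f`. -/
@[nolint unusedArguments]
def PreGNS (f : RepresentableFunctional A) : Type u := A

instance instAddCommGroupPreGNS (f : RepresentableFunctional A) : AddCommGroup f.PreGNS :=
  inferInstanceAs (AddCommGroup A)

instance instModulePreGNS (f : RepresentableFunctional A) : Module ℂ f.PreGNS :=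
  inferInstanceAs (Module ℂ A)

/-- The identity map from `A` to `f.PreGNS`. -/
def toPreGNS (f : RepresentableFunctional A) : A ≃ₗ[ℂ] f.PreGNS := LinearEquiv.refl ℂ _

/-- The semi-inner product `⟨a, b⟩ = f (b* a)` (here in Mathlib's order of the arguments). -/
noncomputable abbrev preGNSCore (f : RepresentableFunctional A) :
    PreInnerProductSpace.Core ℂ f.PreGNS where
  inner a b := f.toLin (star (f.toPreGNS.symm a) * f.toPreGNS.symm b)
  conj_inner_symm a b := by
    obtain ⟨H, i1, i2, i3, π, ζ, h⟩ := f.representable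
    simp only [apply_star_mul h]
    exact inner_conj_symm _ _
  re_inner_nonneg a := by
    obtain ⟨H, i1, i2, i3, π, ζ, h⟩ := f.representable
    simp only [apply_star_mul h]
    exact inner_self_nonneg
  add_left a b c := by rw [map_add, star_add, add_mul, map_add]
  smul_left a b c := by simp [smul_mul_assoc]

noncomputable instance instSeminormedPreGNS (f : RepresentableFunctional A) :
    SeminormedAddCommGroup f.PreGNS :=
  InnerProductSpace.Core.toSeminormedAddCommGroup (c := f.preGNSCore)

noncomputable instance instInnerPreGNS (f : RepresentableFunctional A) :
    InnerProductSpace ℂ f.PreGNS :=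
  InnerProductSpace.ofCore f.preGNSCore

lemma preGNS_inner (f : RepresentableFunctional A) (a b : A) :
    ⟪f.toPreGNS a, f.toPreGNS b⟫_ℂ = f.toLin (star a * b) := rfl

lemma preGNS_norm (f : RepresentableFunctional A) {H : Type*} [NormedAddCommGroup H]
    [InnerProductSpace ℂ H] [CompleteSpace H] {π : A →⋆ₙₐ[ℂ] (H →L[ℂ] H)} {ζ : H}
    (h : ∀ a : A, f.toLin a = ⟪ζ, π a ζ⟫_ℂ) (a : A) : ‖f.toPreGNS a‖ = ‖π a ζ‖ := by
  rw [@norm_eq_sqrt_re_inner ℂ, @norm_eq_sqrt_re_inner ℂ _ _ _ _ (π a ζ), preGNS_inner,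
    apply_star_mul h]

/-- Left multiplication by `a` as an operator of `f.PreGNS`. -/
noncomputable def leftMulLin (f : RepresentableFunctional A) (a : A) :
    f.PreGNS →ₗ[ℂ] f.PreGNS :=
  f.toPreGNS.toLinearMap ∘ₗ LinearMap.mul ℂ A a ∘ₗ f.toPreGNS.symm.toLinearMap

lemma leftMulLin_bound (f : RepresentableFunctional A) (a : A) :
    ∃ C : ℝ, ∀ x : f.PreGNS, ‖f.leftMulLin a x‖ ≤ C * ‖x‖ := by
  obtain ⟨H, i1, i2, i3, π, ζ, h⟩ := f.representable
  refine ⟨‖π a‖, fun x => ?_⟩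
  have h1 : ‖f.leftMulLin a x‖ = ‖π (a * f.toPreGNS.symm x) ζ‖ := f.preGNS_norm h _
  have h2 : ‖x‖ = ‖π (f.toPreGNS.symm x) ζ‖ := f.preGNS_norm h (f.toPreGNS.symm x)
  rw [h1, h2, map_mul]
  exact (π a).le_opNorm _

/-- Left multiplication by `a` as a bounded operator of `f.PreGNS`. -/
noncomputable def leftMul (f : RepresentableFunctional A) (a : A) : f.PreGNS →L[ℂ] f.PreGNS :=
  (f.leftMulLin a).mkContinuousOfExistsBound (f.leftMulLin_bound a)

lemma leftMul_apply (f : RepresentableFunctional A) (a x : A) :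
    f.leftMul a (f.toPreGNS x) = f.toPreGNS (a * x) := rfl

/-- The Hilbert space `H_f` of the GNS construction. -/
abbrev GNS (f : RepresentableFunctional A) : Type u := UniformSpace.Completion f.PreGNS

/-- The canonical map from `A` into `H_f`. -/
noncomputable def toGNS (f : RepresentableFunctional A) (a : A) : f.GNS :=
  (f.toPreGNS a : UniformSpace.Completion f.PreGNS)

lemma toGNS_inner (f : RepresentableFunctional A) (a b : A) :
    ⟪f.toGNS a, f.toGNS b⟫_ℂ = f.toLin (star a * b) :=
  (UniformSpace.Completion.inner_coe (𝕜 := ℂ) (f.toPreGNS a) (f.toPreGNS b)).trans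
    (f.preGNS_inner a b)

lemma toGNS_add (f : RepresentableFunctional A) (a b : A) :
    f.toGNS (a + b) = f.toGNS a + f.toGNS b := by
  simp [toGNS, UniformSpace.Completion.coe_add]

lemma toGNS_smul (f : RepresentableFunctional A) (c : ℂ) (a : A) :
    f.toGNS (c • a) = c • f.toGNS a := by
  simp [toGNS, UniformSpace.Completion.coe_smul]

lemma toGNS_dense (f : RepresentableFunctional A) : DenseRange f.toGNS :=
  UniformSpace.Completion.denseRange_coe (α := f.PreGNS)

/-- Bounded operators of `H_f` that agree on the image of `A` are equal. -/
lemma gns_clm_ext (f : RepresentableFunctional A) {S T : f.GNS →L[ℂ] f.GNS}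
    (h : ∀ x, S (f.toGNS x) = T (f.toGNS x)) : S = T := by
  refine DFunLike.coe_injective (f.toGNS_dense.equalizer S.continuous T.continuous ?_)
  funext x
  exact h x

lemma completion_leftMul_apply (f : RepresentableFunctional A) (a x : A) :
    (f.leftMul a).completion (f.toGNS x) = f.toGNS (a * x) := by
  simp [toGNS, leftMul_apply]

/-- The representation `π_f` of the GNS construction: left multiplication, extended to `H_f`. -/
noncomputable def gnsRep (f : RepresentableFunctional A) :
    A →⋆ₙₐ[ℂ] (f.GNS →L[ℂ] f.GNS) where
  toFun a := (f.leftMul a).completion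
  map_smul' c a := f.gns_clm_ext fun x => by
    simp [completion_leftMul_apply, smul_mul_assoc, toGNS_smul]
  map_zero' := f.gns_clm_ext fun x => by
    have := f.toGNS_smul 0 0
    simp only [zero_smul] at this
    simp [completion_leftMul_apply, this]
  map_add' a b := f.gns_clm_ext fun x => by
    simp [completion_leftMul_apply, add_mul, toGNS_add]
  map_mul' a b := f.gns_clm_ext fun x => by
    simp [completion_leftMul_apply, mul_assoc]
  map_star' a := by
    refine (ContinuousLinearMap.eq_adjoint_iff (f.leftMul (star a)).completion
      (f.leftMul a).completion).mpr fun x y => ?_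
    refine f.toGNS_dense.induction_on₂ (p := fun x y =>
      ⟪(f.leftMul (star a)).completion x, y⟫_ℂ = ⟪x, (f.leftMul a).completion y⟫_ℂ)
      (isClosed_eq (by fun_prop) (by fun_prop)) (fun u v => ?_) x y
    simp [completion_leftMul_apply, toGNS_inner, mul_assoc]

lemma gnsRep_apply (f : RepresentableFunctional A) (a x : A) :
    f.gnsRep a (f.toGNS x) = f.toGNS (a * x) :=
  f.completion_leftMul_apply a x

lemma functional_bound (f : RepresentableFunctional A) :
    ∃ C : ℝ, ∀ x : f.PreGNS, ‖(f.toLin ∘ₗ f.toPreGNS.symm.toLinearMap) x‖ ≤ C * ‖x‖ := by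
  obtain ⟨H, i1, i2, i3, π, ζ, h⟩ := f.representable
  refine ⟨‖ζ‖, fun x => ?_⟩
  have h2 : ‖x‖ = ‖π (f.toPreGNS.symm x) ζ‖ := f.preGNS_norm h (f.toPreGNS.symm x)
  have h1 : (f.toLin ∘ₗ f.toPreGNS.symm.toLinearMap) x = ⟪ζ, π (f.toPreGNS.symm x) ζ⟫_ℂ := h _
  rw [h1, h2]
  exact norm_inner_le_norm _ _

/-- The vector `ζ_f` of the GNS construction: the Riesz representing vector of the bounded linear
functional on `H_f` that maps the class of `a` to `f a`. -/
noncomputable def gnsVec (f : RepresentableFunctional A) : f.GNS :=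
  (InnerProductSpace.toDual ℂ f.GNS).symm
    (((f.toLin ∘ₗ f.toPreGNS.symm.toLinearMap).mkContinuousOfExistsBound
      f.functional_bound).extend (UniformSpace.Completion.toComplL (𝕜 := ℂ) (E := f.PreGNS)))

lemma gnsVec_inner (f : RepresentableFunctional A) (a : A) :
    ⟪f.gnsVec, f.toGNS a⟫_ℂ = f.toLin a := by
  rw [gnsVec, InnerProductSpace.toDual_symm_apply]
  exact ContinuousLinearMap.extend_eq _ UniformSpace.Completion.denseRange_coe
    (UniformSpace.Completion.isUniformInducing_coe f.PreGNS) (f.toPreGNS a)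

/-- `π_f(a) ζ_f` is the class of `a`. In particular `ζ_f` is a cyclic vector. -/
lemma gnsRep_gnsVec (f : RepresentableFunctional A) (a : A) :
    f.gnsRep a f.gnsVec = f.toGNS a := by
  refine f.toGNS_dense.eq_of_inner_left (𝕜 := ℂ) fun x => ?_
  have h1 : f.gnsRep a = ContinuousLinearMap.adjoint (f.gnsRep (star a)) := by
    rw [← ContinuousLinearMap.star_eq_adjoint, ← map_star, star_star]
  rw [h1, ContinuousLinearMap.adjoint_inner_left, gnsRep_apply, toGNS_inner, gnsVec_inner]

/-- The GNS triple `(H_f, π_f, ζ_f)` represents `f`. -/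
lemma gns_represents (f : RepresentableFunctional A) (a : A) :
    f.toLin a = ⟪f.gnsVec, f.gnsRep a f.gnsVec⟫_ℂ := by
  rw [gnsRep_gnsVec, gnsVec_inner]

end GNS

section ParallelSum

variable {A : Type u} [NonUnitalRing A] [StarRing A] [Module ℂ A] [IsScalarTower ℂ A A]
  [SMulCommClass ℂ A A] [StarModule ℂ A]

/-- The functional `a ↦ ⟨π(a) ζ, ζ⟩` of a `*`-representation `π` and a vector `ζ`. -/
noncomputable def ofVector {H : Type u} [NormedAddCommGroup H] [InnerProductSpace ℂ H]
    [CompleteSpace H] (π : A →⋆ₙₐ[ℂ] (H →L[ℂ] H)) (ζ : H) : RepresentableFunctional A where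
  toLin :=
    { toFun := fun a => ⟪ζ, π a ζ⟫_ℂ
      map_add' := fun a b => by simp
      map_smul' := fun c a => by simp }
  representable := ⟨H, inferInstance, inferInstance, inferInstance, π, ζ, fun _ => rfl⟩

/-- The operator `S ⊕ T` of the Hilbert space direct sum `H ⊕ K`. -/
noncomputable def directSumOp {H K : Type u} [NormedAddCommGroup H] [InnerProductSpace ℂ H]
    [NormedAddCommGroup K] [InnerProductSpace ℂ K] (S : H →L[ℂ] H) (T : K →L[ℂ] K) :
    WithLp 2 (H × K) →L[ℂ] WithLp 2 (H × K) :=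
  ((WithLp.prodContinuousLinearEquiv 2 ℂ H K).symm :
      H × K →L[ℂ] WithLp 2 (H × K)) ∘L (S.prodMap T) ∘L
    ((WithLp.prodContinuousLinearEquiv 2 ℂ H K) : WithLp 2 (H × K) →L[ℂ] H × K)

lemma directSumOp_apply {H K : Type u} [NormedAddCommGroup H] [InnerProductSpace ℂ H]
    [NormedAddCommGroup K] [InnerProductSpace ℂ K] (S : H →L[ℂ] H) (T : K →L[ℂ] K)
    (x : WithLp 2 (H × K)) : directSumOp S T x = WithLp.toLp 2 (S x.fst, T x.snd) := rfl

/-- The Hilbert space direct sum of two `*`-representations. -/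
noncomputable def directSumRep {H K : Type u} [NormedAddCommGroup H] [InnerProductSpace ℂ H]
    [CompleteSpace H] [NormedAddCommGroup K] [InnerProductSpace ℂ K] [CompleteSpace K]
    (π : A →⋆ₙₐ[ℂ] (H →L[ℂ] H)) (ρ : A →⋆ₙₐ[ℂ] (K →L[ℂ] K)) :
    A →⋆ₙₐ[ℂ] (WithLp 2 (H × K) →L[ℂ] WithLp 2 (H × K)) where
  toFun a := directSumOp (π a) (ρ a)
  map_smul' c a := ContinuousLinearMap.ext fun x => by
    simp only [directSumOp_apply, map_smul]; rfl
  map_zero' := ContinuousLinearMap.ext fun x => by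
    simp only [directSumOp_apply, map_zero]; rfl
  map_add' a b := ContinuousLinearMap.ext fun x => by
    simp only [directSumOp_apply, map_add]; rfl
  map_mul' a b := ContinuousLinearMap.ext fun x => by
    simp only [directSumOp_apply, map_mul]; rfl
  map_star' a := by
    refine (ContinuousLinearMap.eq_adjoint_iff _ _).mpr fun x y => ?_
    rw [directSumOp_apply, directSumOp_apply, WithLp.prod_inner_apply, WithLp.prod_inner_apply,
      map_star, map_star, ContinuousLinearMap.star_eq_adjoint, ContinuousLinearMap.star_eq_adjoint]
    change ⟪ContinuousLinearMap.adjoint (π a) x.fst, y.fst⟫_ℂ +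
        ⟪ContinuousLinearMap.adjoint (ρ a) x.snd, y.snd⟫_ℂ =
      ⟪x.fst, π a y.fst⟫_ℂ + ⟪x.snd, ρ a y.snd⟫_ℂ
    rw [ContinuousLinearMap.adjoint_inner_left, ContinuousLinearMap.adjoint_inner_left]

lemma directSumRep_apply {H K : Type u} [NormedAddCommGroup H] [InnerProductSpace ℂ H]
    [CompleteSpace H] [NormedAddCommGroup K] [InnerProductSpace ℂ K] [CompleteSpace K]
    (π : A →⋆ₙₐ[ℂ] (H →L[ℂ] H)) (ρ : A →⋆ₙₐ[ℂ] (K →L[ℂ] K)) (a : A) (x : H) (y : K) :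
    directSumRep π ρ a (WithLp.toLp 2 (x, y)) = WithLp.toLp 2 (π a x, ρ a y) := rfl

/-- The closure of the subspace `{π(a) ζ ⊕ ρ(a) ξ : a ∈ A}` of `H ⊕ K`. -/
noncomputable def diagonalSubspace {H K : Type u} [NormedAddCommGroup H] [InnerProductSpace ℂ H]
    [CompleteSpace H] [NormedAddCommGroup K] [InnerProductSpace ℂ K] [CompleteSpace K]
    (π : A →⋆ₙₐ[ℂ] (H →L[ℂ] H)) (ζ : H) (ρ : A →⋆ₙₐ[ℂ] (K →L[ℂ] K)) (ξ : K) :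
    Submodule ℂ (WithLp 2 (H × K)) :=
  (LinearMap.range
    ({ toFun := fun a => WithLp.toLp 2 (π a ζ, ρ a ξ)
       map_add' := fun a b => by simp only [map_add]; rfl
       map_smul' := fun c a => by simp only [map_smul]; rfl } : A →ₗ[ℂ] WithLp 2 (H × K))).topologicalClosure

instance instHasOrthogonalProjectionDiagonal {H K : Type u} [NormedAddCommGroup H]
    [InnerProductSpace ℂ H] [CompleteSpace H] [NormedAddCommGroup K] [InnerProductSpace ℂ K]
    [CompleteSpace K] (π : A →⋆ₙₐ[ℂ] (H →L[ℂ] H)) (ζ : H) (ρ : A →⋆ₙₐ[ℂ] (K →L[ℂ] K)) (ξ : K) :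
    (diagonalSubspace π ζ ρ ξ).HasOrthogonalProjection :=
  haveI : CompleteSpace (diagonalSubspace π ζ ρ ξ) :=
    (Submodule.isClosed_topologicalClosure _).completeSpace_coe
  inferInstance

/-- The vector `P (ζ ⊕ 0)`, with `P` the orthogonal projection of `H ⊕ K` onto the
orthogonal complement of `diagonalSubspace π ζ ρ ξ`. -/
noncomputable def parallelVec {H K : Type u} [NormedAddCommGroup H] [InnerProductSpace ℂ H]
    [CompleteSpace H] [NormedAddCommGroup K] [InnerProductSpace ℂ K] [CompleteSpace K]
    (π : A →⋆ₙₐ[ℂ] (H →L[ℂ] H)) (ζ : H) (ρ : A →⋆ₙₐ[ℂ] (K →L[ℂ] K)) (ξ : K) :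
    WithLp 2 (H × K) :=
  (diagonalSubspace π ζ ρ ξ).orthogonal.starProjection (WithLp.toLp 2 (ζ, 0))

/-- The parallel sum `f : g`, i.e. `(f : g) a = ⟨π(a) P (ζ_f ⊕ 0), P (ζ_f ⊕ 0)⟩`
where `π` is the direct sum of `π_f` and `π_g`. -/
noncomputable def parallelSum (f g : RepresentableFunctional A) : RepresentableFunctional A :=
  ofVector (directSumRep f.gnsRep g.gnsRep) (parallelVec f.gnsRep f.gnsVec g.gnsRep g.gnsVec)

open Classical in
/-- `[g]f`, the supremum over `n` of the parallel sums `f : (n g)` in the ordered set of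
representable functionals (with the value `0` if there were no supremum). -/
noncomputable def absContPart (g f : RepresentableFunctional A) : RepresentableFunctional A :=
  if h : ∃ s, IsLUB (Set.range fun n : ℕ => parallelSum f (n • g)) s then h.choose else 0

end ParallelSum

end RepresentableFunctional

open ContinuousLinearMap (adjoint adjoint_inner_left adjoint_inner_right)
set_option linter.unusedSectionVars false

/-! Everything is transported to the single Hilbert space `f.GNS`. Since `g ≤ f`, the map `f.toGNS a
↦ g.toGNS a` extends to a contraction `J`, and `W = J* J` satisfies `0 ≤ W ≤ 1`, commutes with
`f.gnsRep`, and recovers `g` by `g a = ⟪ζ_f, W π_f(a) ζ_f⟫`. Each of the three statements turns out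
to say `W² = W`.

Supremum: `(f : ng)(a* a)` is the minimum over `x` of `‖a - x‖² + n ‖J x‖²`, which increases to the
squared distance from `a` to `ker J`. Hence the supremum is the functional of the projection `P`
onto the closed range of `W` (`isLUB_parallelSum`), and it equals `g` exactly when `W = P`
(`absContPart_eq_self_iff`).

Singularity: `(1 - W) W (1 - W)` is dominated by both `W` and `1 - W`, so singularity makes it
vanish, giving `W = W²`; conversely a form below a projection and its complement is zero
(`singular_sub_iff`).

Extremality: `W` is the midpoint of `W²` and `2W - W² = 1 - (1 - W)²`, both between `0` and `1`;
conversely projections are extreme among the operators between `0` and `1`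
(`mem_extremePoints_interval_iff`). -/

namespace RepresentableFunctional

/-! ### The order in terms of GNS norms, and the comparison operator. -/

section Comparison

variable {A : Type u} [NonUnitalRing A] [StarRing A] [Module ℂ A] [IsScalarTower ℂ A A]
  [SMulCommClass ℂ A A] [StarModule ℂ A] {f g h k : RepresentableFunctional A}

lemma apply_star_mul_self (f : RepresentableFunctional A) (a : A) :
    f.toLin (star a * a) = ((‖f.toGNS a‖ ^ 2 : ℝ) : ℂ) := by
  rw [← toGNS_inner, inner_self_eq_norm_sq_to_K]
  norm_cast

lemma le_iff_norm : h ≤ f ↔ ∀ a, ‖h.toGNS a‖ ^ 2 ≤ ‖f.toGNS a‖ ^ 2 := by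
  refine forall_congr' fun a => ?_
  rw [LinearMap.sub_apply, apply_star_mul_self, apply_star_mul_self, ← Complex.ofReal_sub,
    Complex.ofReal_re, Complex.ofReal_im, sub_nonneg]
  simp

lemma isPositiveFunctional_iff_zero_le {φ : RepresentableFunctional A} :
    (0 : RepresentableFunctional A) ≤ φ ↔ IsPositiveFunctional φ.toLin := by
  change IsPositiveFunctional (φ.toLin - 0) ↔ _
  rw [sub_zero]

lemma zero_le (φ : RepresentableFunctional A) : (0 : RepresentableFunctional A) ≤ φ := by
  rw [isPositiveFunctional_iff_zero_le]
  intro a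
  rw [apply_star_mul_self, Complex.ofReal_re, Complex.ofReal_im]
  exact ⟨by positivity, rfl⟩

/-- A dominated functional gives a bounded comparison operator between the GNS spaces. -/
lemma exists_comparison (C : ℝ) (hC : ∀ a, ‖h.toGNS a‖ ≤ C * ‖f.toGNS a‖) :
    ∃ J : f.GNS →L[ℂ] h.GNS, ∀ a, J (f.toGNS a) = h.toGNS a := by
  let L : f.PreGNS →ₗ[ℂ] h.PreGNS := h.toPreGNS.toLinearMap ∘ₗ f.toPreGNS.symm.toLinearMap
  have hL : ∀ x, ‖L x‖ ≤ C * ‖x‖ := fun x => by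
    have := hC (f.toPreGNS.symm x)
    rwa [toGNS, toGNS, UniformSpace.Completion.norm_coe, UniformSpace.Completion.norm_coe] at this
  exact ⟨(L.mkContinuous C hL).completion, fun a =>
    ContinuousLinearMap.completion_apply_coe _ _⟩

lemma exists_comparison_of_le (hfh : h ≤ f) :
    ∃ J : f.GNS →L[ℂ] h.GNS, ∀ a, J (f.toGNS a) = h.toGNS a := by
  refine exists_comparison 1 fun a => ?_
  rw [one_mul]
  exact (sq_le_sq₀ (norm_nonneg _) (norm_nonneg _)).1 (le_iff_norm.1 hfh a)

end Comparison
-- Comparison operators as intertwiners; functionals built from the commutant.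
section Intertwiner

variable {A : Type u} [NonUnitalRing A] [StarRing A] [Module ℂ A] [IsScalarTower ℂ A A]
  [SMulCommClass ℂ A A] [StarModule ℂ A] {f g h : RepresentableFunctional A}
  {J : f.GNS →L[ℂ] g.GNS}

lemma comparison_gnsRep (hJ : ∀ a, J (f.toGNS a) = g.toGNS a) (a : A) (x : f.GNS) :
    J (f.gnsRep a x) = g.gnsRep a (J x) := by
  refine f.toGNS_dense.induction_on (p := fun x => J (f.gnsRep a x) = g.gnsRep a (J x)) x
    (isClosed_eq (by fun_prop) (by fun_prop)) fun b => ?_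
  rw [gnsRep_apply, hJ, hJ, gnsRep_apply]

lemma gnsRep_inner_left (f : RepresentableFunctional A) (a : A) (x y : f.GNS) :
    ⟪f.gnsRep a x, y⟫_ℂ = ⟪x, f.gnsRep (star a) y⟫_ℂ := by
  rw [map_star, ContinuousLinearMap.star_eq_adjoint, adjoint_inner_right]

/-- The representation of the GNS construction is nondegenerate. -/
lemma eq_of_gnsRep_eq {x y : f.GNS} (hxy : ∀ a, f.gnsRep a x = f.gnsRep a y) : x = y := by
  refine f.toGNS_dense.eq_of_inner_right (𝕜 := ℂ) fun a => ?_
  rw [← gnsRep_gnsVec, gnsRep_inner_left, gnsRep_inner_left, hxy]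

/-- Both vectors have the same orbit under `g.gnsRep`, so nondegeneracy identifies them. With no
unit in `A`, the cyclic vector need not be the class of an element. -/
lemma comparison_gnsVec (hJ : ∀ a, J (f.toGNS a) = g.toGNS a) : J f.gnsVec = g.gnsVec := by
  refine eq_of_gnsRep_eq fun a => ?_
  rw [← comparison_gnsRep hJ, gnsRep_gnsVec, gnsRep_gnsVec, hJ]

lemma adjoint_comparison_gnsRep (hJ : ∀ a, J (f.toGNS a) = g.toGNS a) (a : A) (y : g.GNS) :
    adjoint J (g.gnsRep a y) = f.gnsRep a (adjoint J y) := by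
  refine ext_inner_right ℂ fun x => ?_
  rw [adjoint_inner_left, gnsRep_inner_left, gnsRep_inner_left, adjoint_inner_left,
    comparison_gnsRep hJ]

lemma gram_gnsRep (hJ : ∀ a, J (f.toGNS a) = g.toGNS a) (a : A) (x : f.GNS) :
    adjoint J (J (f.gnsRep a x)) = f.gnsRep a (adjoint J (J x)) := by
  rw [comparison_gnsRep hJ, adjoint_comparison_gnsRep hJ]

lemma norm_comparison_le (hJ : ∀ a, J (f.toGNS a) = g.toGNS a) (hgf : g ≤ f) (x : f.GNS) :
    ‖J x‖ ≤ ‖x‖ := by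
  refine f.toGNS_dense.induction_on (p := fun x => ‖J x‖ ≤ ‖x‖) x
    (isClosed_le (by fun_prop) (by fun_prop)) fun a => ?_
  rw [hJ]
  exact (sq_le_sq₀ (norm_nonneg _) (norm_nonneg _)).1 (le_iff_norm.1 hgf a)

lemma toLin_eq_inner_gram (hJ : ∀ a, J (f.toGNS a) = g.toGNS a) (a : A) :
    g.toLin a = ⟪f.gnsVec, adjoint J (J (f.toGNS a))⟫_ℂ := by
  rw [adjoint_inner_right, comparison_gnsVec hJ, hJ, gnsVec_inner]

/-- A representable functional is determined by its order class. -/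
lemma eq_of_le_of_le (h₁ : g ≤ f) (h₂ : f ≤ g) : g = f := by
  obtain ⟨J, hJ⟩ := exists_comparison_of_le h₁
  have hn : ∀ x, ‖J x‖ = ‖x‖ := fun x => by
    refine f.toGNS_dense.induction_on (p := fun x => ‖J x‖ = ‖x‖) x
      (isClosed_eq (by fun_prop) (by fun_prop)) fun a => ?_
    rw [hJ]
    exact (sq_eq_sq₀ (norm_nonneg _) (norm_nonneg _)).1
      (le_antisymm (le_iff_norm.1 h₁ a) (le_iff_norm.1 h₂ a))
  have hi : ∀ x y, ⟪J x, J y⟫_ℂ = ⟪x, y⟫_ℂ :=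
    fun x y => (⟨J.toLinearMap, hn⟩ : f.GNS →ₗᵢ[ℂ] g.GNS).inner_map_map x y
  -- Values on products alone need not determine a functional on a non-unital algebra; the cyclic
  -- vectors supply the remaining values.
  have : g.toLin = f.toLin := LinearMap.ext fun a => by
    rw [toLin_eq_inner_gram hJ, adjoint_inner_right, hi, gnsVec_inner]
  cases f; cases g; cases this; rfl

/-- The functional `a ↦ ⟨π_f(a) S ζ_f, S ζ_f⟩` of a bounded operator `S`. -/
noncomputable def ofOperator (f : RepresentableFunctional A) (S : f.GNS →L[ℂ] f.GNS) :
    RepresentableFunctional A :=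
  ofVector f.gnsRep (S f.gnsVec)

lemma ofOperator_apply {S : f.GNS →L[ℂ] f.GNS}
    (hS : ∀ a x, S (f.gnsRep a x) = f.gnsRep a (S x)) (a : A) :
    (f.ofOperator S).toLin a = ⟪S f.gnsVec, S (f.toGNS a)⟫_ℂ := by
  rw [← gnsRep_gnsVec, hS]
  rfl

lemma norm_toGNS_ofVector {H : Type u} [NormedAddCommGroup H] [InnerProductSpace ℂ H]
    [CompleteSpace H] (π : A →⋆ₙₐ[ℂ] (H →L[ℂ] H)) (ζ : H) (a : A) :
    ‖(ofVector π ζ).toGNS a‖ = ‖π a ζ‖ := by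
  rw [toGNS, UniformSpace.Completion.norm_coe]
  exact preGNS_norm _ (fun _ => rfl) a

lemma norm_toGNS_ofOperator {S : f.GNS →L[ℂ] f.GNS}
    (hS : ∀ a x, S (f.gnsRep a x) = f.gnsRep a (S x)) (a : A) :
    ‖(f.ofOperator S).toGNS a‖ = ‖S (f.toGNS a)‖ := by
  rw [← f.gnsRep_gnsVec, hS]
  exact norm_toGNS_ofVector _ _ _

/-- What commutes with `T` commutes with its functional calculus. This lets a positive `T` in the
commutant be factored as `S* S` with `S` again in the commutant, so that `T` comes from a
representable functional. -/
lemma sqrt_commute_gnsRep {T : f.GNS →L[ℂ] f.GNS}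
    (hT : ∀ a x, T (f.gnsRep a x) = f.gnsRep a (T x)) (a : A) (x : f.GNS) :
    CFC.sqrt T (f.gnsRep a x) = f.gnsRep a (CFC.sqrt T x) := by
  have hc : Commute T (f.gnsRep a) := ContinuousLinearMap.ext fun x => hT a x
  exact congrArg (fun S : f.GNS →L[ℂ] f.GNS => S x) (hc.cfcₙ_nnreal NNReal.sqrt).eq

lemma adjoint_sqrt_sqrt_apply {T : f.GNS →L[ℂ] f.GNS} (hT : T.IsPositive) (x : f.GNS) :
    adjoint (CFC.sqrt T) (CFC.sqrt T x) = T x := by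
  have h0 : 0 ≤ T := (ContinuousLinearMap.nonneg_iff_isPositive T).2 hT
  have h1 : IsSelfAdjoint (CFC.sqrt T) := (CFC.sqrt_nonneg T).isSelfAdjoint
  rw [← ContinuousLinearMap.star_eq_adjoint, h1.star_eq]
  exact congrArg (fun S : f.GNS →L[ℂ] f.GNS => S x) (CFC.sqrt_mul_sqrt_self T h0)

end Intertwiner

/-! ### The parallel sum as a minimum over the graph of the comparison operator. -/

section ParallelSumMinimum

variable {A : Type u} [NonUnitalRing A] [StarRing A] [Module ℂ A] [IsScalarTower ℂ A A]
  [SMulCommClass ℂ A A] [StarModule ℂ A] {f g h : RepresentableFunctional A}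
  {J : f.GNS →L[ℂ] g.GNS}

/-- The diagonal subspace of the two GNS representations. -/
noncomputable abbrev gnsDiagonal (f g : RepresentableFunctional A) :
    Submodule ℂ (WithLp 2 (f.GNS × g.GNS)) :=
  diagonalSubspace f.gnsRep f.gnsVec g.gnsRep g.gnsVec

lemma toLp_toGNS_mem_gnsDiagonal (f g : RepresentableFunctional A) (a : A) :
    WithLp.toLp 2 (f.toGNS a, g.toGNS a) ∈ gnsDiagonal f g := by
  refine Submodule.le_topologicalClosure _ ⟨a, ?_⟩
  change WithLp.toLp 2 (f.gnsRep a f.gnsVec, g.gnsRep a g.gnsVec) = _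
  rw [gnsRep_gnsVec, gnsRep_gnsVec]

lemma gnsDiagonal_induction {p : WithLp 2 (f.GNS × g.GNS) → Prop}
    (hp : IsClosed {x | p x}) (hd : ∀ a, p (WithLp.toLp 2 (f.toGNS a, g.toGNS a)))
    {x : WithLp 2 (f.GNS × g.GNS)} (hx : x ∈ gnsDiagonal f g) : p x := by
  refine closure_minimal (t := {x | p x}) ?_ hp hx
  rintro _ ⟨a, rfl⟩
  change p (WithLp.toLp 2 (f.gnsRep a f.gnsVec, g.gnsRep a g.gnsVec))
  rw [gnsRep_gnsVec, gnsRep_gnsVec]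
  exact hd a

lemma isClosed_gnsDiagonal : IsClosed (gnsDiagonal f g : Set (WithLp 2 (f.GNS × g.GNS))) :=
  Submodule.isClosed_topologicalClosure _

/-- The diagonal subspace is the graph of the comparison operator. -/
lemma mem_gnsDiagonal_iff (hJ : ∀ a, J (f.toGNS a) = g.toGNS a)
    {x : WithLp 2 (f.GNS × g.GNS)} : x ∈ gnsDiagonal f g ↔ x.snd = J x.fst := by
  constructor
  · intro hx
    refine gnsDiagonal_induction (p := fun x => x.snd = J x.fst)
      (isClosed_eq (by fun_prop) (by fun_prop)) (fun a => (hJ a).symm) hx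
  · intro hx
    have : ∀ y : f.GNS, WithLp.toLp 2 (y, J y) ∈ gnsDiagonal f g := fun y => by
      refine f.toGNS_dense.induction_on (p := fun y => WithLp.toLp 2 (y, J y) ∈ gnsDiagonal f g) y
        (isClosed_gnsDiagonal.preimage (by fun_prop)) fun a => ?_
      rw [hJ]
      exact toLp_toGNS_mem_gnsDiagonal f g a
    have h2 : x = WithLp.toLp 2 (x.fst, J x.fst) := by rw [← hx]; rfl
    rw [h2]
    exact this _

lemma directSumRep_mem_gnsDiagonal (a : A) {x : WithLp 2 (f.GNS × g.GNS)}
    (hx : x ∈ gnsDiagonal f g) : directSumRep f.gnsRep g.gnsRep a x ∈ gnsDiagonal f g := by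
  refine gnsDiagonal_induction (p := fun x =>
    directSumRep f.gnsRep g.gnsRep a x ∈ gnsDiagonal f g)
    (isClosed_gnsDiagonal.preimage (by fun_prop)) (fun b => ?_) hx
  rw [directSumRep_apply, gnsRep_apply, gnsRep_apply]
  exact toLp_toGNS_mem_gnsDiagonal f g _

lemma directSumRep_mem_orthogonal (a : A) {x : WithLp 2 (f.GNS × g.GNS)}
    (hx : x ∈ (gnsDiagonal f g)ᗮ) : directSumRep f.gnsRep g.gnsRep a x ∈ (gnsDiagonal f g)ᗮ := by
  intro y hy
  rw [← adjoint_inner_left, ← ContinuousLinearMap.star_eq_adjoint, ← map_star]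
  exact hx _ (directSumRep_mem_gnsDiagonal _ hy)

/-- The parallel sum is the squared distance from the diagonal subspace. -/
lemma norm_toGNS_parallelSum (f g : RepresentableFunctional A) (a : A) :
    ‖(parallelSum f g).toGNS a‖ =
      ‖(gnsDiagonal f g)ᗮ.starProjection (WithLp.toLp 2 (f.toGNS a, 0))‖ := by
  have h0 : (WithLp.toLp 2 (f.toGNS a, 0) : WithLp 2 (f.GNS × g.GNS)) =
      directSumRep f.gnsRep g.gnsRep a (WithLp.toLp 2 (f.gnsVec, 0)) := by
    rw [directSumRep_apply, gnsRep_gnsVec, map_zero]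
  rw [parallelSum, norm_toGNS_ofVector, h0, parallelVec]
  congr 1
  symm
  -- The diagonal and its orthogonal complement are both invariant, so the projection commutes with
  -- the representation and can be moved past `a`.
  refine Submodule.eq_starProjection_of_mem_of_inner_eq_zero ?_ ?_
  · exact directSumRep_mem_orthogonal a (Submodule.starProjection_apply_mem _ _)
  · intro w hw
    rw [← map_sub]
    refine Submodule.inner_right_of_mem_orthogonal (K := gnsDiagonal f g) ?_ hw
    refine directSumRep_mem_gnsDiagonal a ?_
    rw [Submodule.starProjection_orthogonal_val, sub_sub_cancel]
    exact Submodule.starProjection_apply_mem _ _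

/-- Subtracting the graph vector `(x, J x)` does not change the projection onto the orthogonal
complement, and a projection is a contraction. -/
lemma norm_toGNS_parallelSum_sq_le (hJ : ∀ a, J (f.toGNS a) = g.toGNS a) (a : A) (x : f.GNS) :
    ‖(parallelSum f g).toGNS a‖ ^ 2 ≤ ‖f.toGNS a - x‖ ^ 2 + ‖J x‖ ^ 2 := by
  have hd : (WithLp.toLp 2 (x, J x) : WithLp 2 (f.GNS × g.GNS)) ∈ gnsDiagonal f g :=
    (mem_gnsDiagonal_iff hJ).2 rfl
  have h0 : (gnsDiagonal f g)ᗮ.starProjection (WithLp.toLp 2 (f.toGNS a, 0)) =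
      (gnsDiagonal f g)ᗮ.starProjection (WithLp.toLp 2 (f.toGNS a - x, -J x)) := by
    have h1 : (WithLp.toLp 2 (f.toGNS a - x, -J x) : WithLp 2 (f.GNS × g.GNS)) =
        WithLp.toLp 2 (f.toGNS a, 0) - WithLp.toLp 2 (x, J x) := by
      rw [← WithLp.toLp_sub, Prod.mk_sub_mk, zero_sub]
    rw [h1, map_sub, Submodule.starProjection_orthogonal_apply_eq_zero hd, sub_zero]
  rw [norm_toGNS_parallelSum, h0]
  refine (pow_le_pow_left₀ (norm_nonneg _)
    (Submodule.norm_starProjection_apply_le _ _) 2).trans_eq ?_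
  rw [WithLp.prod_norm_sq_eq_of_L2]
  simp

lemma exists_norm_toGNS_parallelSum_sq_eq (hJ : ∀ a, J (f.toGNS a) = g.toGNS a) (a : A) :
    ∃ x : f.GNS, ‖(parallelSum f g).toGNS a‖ ^ 2 = ‖f.toGNS a - x‖ ^ 2 + ‖J x‖ ^ 2 := by
  -- The minimum is attained at the point of the graph nearest to `(a, 0)`.
  set d := (gnsDiagonal f g).starProjection (WithLp.toLp 2 (f.toGNS a, 0)) with hd
  have h1 : d.snd = J d.fst :=
    (mem_gnsDiagonal_iff hJ).1 (Submodule.starProjection_apply_mem _ _)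
  refine ⟨d.fst, ?_⟩
  rw [norm_toGNS_parallelSum, Submodule.starProjection_orthogonal_val, ← hd,
    WithLp.prod_norm_sq_eq_of_L2, ← h1]
  simp

end ParallelSumMinimum
-- The supremum of the parallel sums `f : (n g)`.
section Supremum

variable {A : Type u} [NonUnitalRing A] [StarRing A] [Module ℂ A] [IsScalarTower ℂ A A]
  [SMulCommClass ℂ A A] [StarModule ℂ A] {f g h : RepresentableFunctional A}
  {J : f.GNS →L[ℂ] g.GNS}

lemma norm_toGNS_nsmul_sq (g : RepresentableFunctional A) (n : ℕ) (a : A) :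
    ‖(n • g).toGNS a‖ ^ 2 = n * ‖g.toGNS a‖ ^ 2 := by
  have h1 := apply_star_mul_self (n • g) a
  have h2 : (n • g).toLin (star a * a) = (n : ℂ) * g.toLin (star a * a) := rfl
  rw [h2, apply_star_mul_self] at h1
  exact_mod_cast h1.symm

lemma exists_comparison_nsmul (hJ : ∀ a, J (f.toGNS a) = g.toGNS a) (n : ℕ) :
    ∃ K : f.GNS →L[ℂ] (n • g).GNS, (∀ a, K (f.toGNS a) = (n • g).toGNS a) ∧
      ∀ x, ‖K x‖ ^ 2 = n * ‖J x‖ ^ 2 := by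
  -- For large `n` the functional `n g` need not lie below `f`; the constant comes from `‖(n g) a‖²
  -- = n ‖J a‖²`.
  obtain ⟨K, hK⟩ := exists_comparison (f := f) (h := n • g) (√n * ‖J‖) fun a => by
    refine (sq_le_sq₀ (norm_nonneg _) (by positivity)).1 ?_
    rw [norm_toGNS_nsmul_sq, mul_assoc, mul_pow, Real.sq_sqrt n.cast_nonneg, ← hJ]
    gcongr
    exact J.le_opNorm _
  refine ⟨K, hK, fun x => ?_⟩
  refine f.toGNS_dense.induction_on (p := fun x => ‖K x‖ ^ 2 = n * ‖J x‖ ^ 2) x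
    (isClosed_eq (by fun_prop) (by fun_prop)) fun a => ?_
  rw [hK, hJ, norm_toGNS_nsmul_sq]

/-- The closure of the range of `J* J`. -/
noncomputable def gramSupport (J : f.GNS →L[ℂ] g.GNS) : Submodule ℂ f.GNS :=
  (LinearMap.range (adjoint J ∘L J).toLinearMap).topologicalClosure

instance instHasOrthogonalProjectionGramSupport (J : f.GNS →L[ℂ] g.GNS) :
    (gramSupport J).HasOrthogonalProjection :=
  haveI : CompleteSpace (gramSupport J) :=
    (Submodule.isClosed_topologicalClosure _).completeSpace_coe
  inferInstance

lemma gram_mem_gramSupport (J : f.GNS →L[ℂ] g.GNS) (x : f.GNS) :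
    adjoint J (J x) ∈ gramSupport J :=
  Submodule.le_topologicalClosure _ ⟨x, rfl⟩

lemma gramSupport_induction {p : f.GNS → Prop} (hp : IsClosed {x | p x})
    (hJ : ∀ x, p (adjoint J (J x))) {x : f.GNS} (hx : x ∈ gramSupport J) : p x := by
  refine closure_minimal (t := {x | p x}) ?_ hp hx
  rintro _ ⟨y, rfl⟩
  exact hJ y

lemma comparison_eq_zero_of_mem_orthogonal {x : f.GNS} (hx : x ∈ (gramSupport J)ᗮ) : J x = 0 := by
  rw [← inner_self_eq_zero (𝕜 := ℂ), ← adjoint_inner_left]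
  exact hx _ (gram_mem_gramSupport J x)

lemma gnsRep_mem_gramSupport (hJ : ∀ a, J (f.toGNS a) = g.toGNS a) (a : A) {x : f.GNS}
    (hx : x ∈ gramSupport J) : f.gnsRep a x ∈ gramSupport J := by
  refine gramSupport_induction (p := fun x => f.gnsRep a x ∈ gramSupport J)
    ((Submodule.isClosed_topologicalClosure _).preimage (by fun_prop)) (fun y => ?_) hx
  rw [← gram_gnsRep hJ]
  exact gram_mem_gramSupport J _

lemma starProjection_gramSupport_gnsRep (hJ : ∀ a, J (f.toGNS a) = g.toGNS a) (a : A)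
    (x : f.GNS) : (gramSupport J).starProjection (f.gnsRep a x) =
      f.gnsRep a ((gramSupport J).starProjection x) := by
  refine Submodule.eq_starProjection_of_mem_of_inner_eq_zero
    (gnsRep_mem_gramSupport hJ a (Submodule.starProjection_apply_mem _ _)) fun w hw => ?_
  rw [← map_sub, gnsRep_inner_left]
  exact Submodule.starProjection_inner_eq_zero _ _ (gnsRep_mem_gramSupport hJ _ hw)

/-- Lower bound for the parallel sums `f : (n g)`. -/
lemma norm_inner_gram_sq_le (hJ : ∀ a, J (f.toGNS a) = g.toGNS a) {n : ℕ} (hn : 0 < n) (a : A)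
    (z : f.GNS) : ‖⟪adjoint J (J z), f.toGNS a⟫_ℂ‖ ^ 2 ≤
      (‖adjoint J (J z)‖ ^ 2 + ‖J z‖ ^ 2 / n) * ‖(parallelSum f (n • g)).toGNS a‖ ^ 2 := by
  obtain ⟨K, hK, hKJ⟩ := exists_comparison_nsmul hJ n
  obtain ⟨x, hx⟩ := exists_norm_toGNS_parallelSum_sq_eq hK a
  have hn' : (0 : ℝ) < n := by exact_mod_cast hn
  have h1 : ‖⟪adjoint J (J z), f.toGNS a⟫_ℂ‖ ≤
      ‖adjoint J (J z)‖ * ‖f.toGNS a - x‖ + ‖J z‖ * ‖J x‖ := by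
    have : ⟪adjoint J (J z), f.toGNS a⟫_ℂ =
        ⟪adjoint J (J z), f.toGNS a - x⟫_ℂ + ⟪J z, J x⟫_ℂ := by
      rw [← adjoint_inner_left, ← inner_add_right, sub_add_cancel]
    rw [this]
    exact (norm_add_le _ _).trans (add_le_add (norm_inner_le_norm _ _) (norm_inner_le_norm _ _))
  rw [hx, hKJ]
  refine (pow_le_pow_left₀ (norm_nonneg _) h1 2).trans ?_
  set p := ‖adjoint J (J z)‖
  set q := ‖f.toGNS a - x‖
  set r := ‖J z‖
  set s := ‖J x‖
  -- The Lagrange identity: the exact defect in the Cauchy–Schwarz inequality for `(p, r/√n)` and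
  -- `(q, √n s)`.
  have : (p ^ 2 + r ^ 2 / n) * (q ^ 2 + n * s ^ 2) - (p * q + r * s) ^ 2 =
      (n * p * s - q * r) ^ 2 / n := by
    field_simp
    ring
  have h2 : 0 ≤ (n * p * s - q * r) ^ 2 / n := by positivity
  linarith

/-- The penalty `n ‖J x‖²` forces `x` towards `ker J`, the orthogonal complement of `gramSupport J`.
A point of `ker J` gives the upper bound; letting `n → ∞` in `norm_inner_gram_sq_le` shows that no
smaller bound is possible. -/
lemma isLUB_parallelSum (hJ : ∀ a, J (f.toGNS a) = g.toGNS a) :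
    IsLUB (Set.range fun n : ℕ => parallelSum f (n • g))
      (f.ofOperator (gramSupport J).starProjection) := by
  constructor
  · rintro _ ⟨n, rfl⟩
    refine le_iff_norm.2 fun a => ?_
    obtain ⟨K, hK, hKJ⟩ := exists_comparison_nsmul hJ n
    -- This test point is the component of `a` in `ker J`, so the penalty vanishes for every `n`.
    refine (norm_toGNS_parallelSum_sq_le hK a
      (f.toGNS a - (gramSupport J).starProjection (f.toGNS a))).trans_eq ?_
    rw [hKJ, comparison_eq_zero_of_mem_orthogonal
      (Submodule.sub_starProjection_mem_orthogonal _), sub_sub_cancel,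
      norm_toGNS_ofOperator (starProjection_gramSupport_gnsRep hJ)]
    simp
  · intro k hk
    refine le_iff_norm.2 fun a => ?_
    rw [norm_toGNS_ofOperator (starProjection_gramSupport_gnsRep hJ)]
    set P := (gramSupport J).starProjection
    set c := ‖k.toGNS a‖ ^ 2
    have hc : 0 ≤ c := by positivity
    have h1 : ∀ z, ‖⟪adjoint J (J z), f.toGNS a⟫_ℂ‖ ^ 2 ≤ ‖adjoint J (J z)‖ ^ 2 * c := by
      intro z
      have hlim : Filter.Tendsto (fun n : ℕ => (‖adjoint J (J z)‖ ^ 2 + ‖J z‖ ^ 2 / n) * c)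
          Filter.atTop (nhds ((‖adjoint J (J z)‖ ^ 2 + 0) * c)) :=
        (tendsto_const_nhds.add (tendsto_const_div_atTop_nhds_zero_nat _)).mul_const c
      rw [add_zero] at hlim
      refine ge_of_tendsto hlim (Filter.eventually_atTop.2 ⟨1, fun n hn => ?_⟩)
      refine (norm_inner_gram_sq_le hJ hn a z).trans ?_
      gcongr
      exact le_iff_norm.1 (hk ⟨n, rfl⟩) a
    -- The limiting bound on the range of `W` passes to its closure, which contains `P a`; there it
    -- reads `‖P a‖⁴ ≤ ‖P a‖² c`.
    have h2 : ‖⟪P (f.toGNS a), f.toGNS a⟫_ℂ‖ ^ 2 ≤ ‖P (f.toGNS a)‖ ^ 2 * c :=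
      gramSupport_induction (p := fun x => ‖⟪x, f.toGNS a⟫_ℂ‖ ^ 2 ≤ ‖x‖ ^ 2 * c)
        (isClosed_le (by fun_prop) (by fun_prop)) h1 (Submodule.starProjection_apply_mem _ _)
    have h3 : ⟪P (f.toGNS a), f.toGNS a⟫_ℂ = ((‖P (f.toGNS a)‖ ^ 2 : ℝ) : ℂ) := by
      have hP : P (P (f.toGNS a)) = P (f.toGNS a) :=
        Submodule.starProjection_eq_self_iff.2 (Submodule.starProjection_apply_mem _ _)
      rw [← hP, Submodule.inner_starProjection_left_eq_right, hP, inner_self_eq_norm_sq_to_K]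
      norm_cast
    rw [h3, Complex.norm_real, Real.norm_of_nonneg (by positivity)] at h2
    rcases (norm_nonneg (P (f.toGNS a))).eq_or_lt with h0 | h0
    · rw [← h0]
      simpa using hc
    · exact le_of_mul_le_mul_left (by rwa [pow_two] at h2) (pow_pos h0 2)

lemma absContPart_eq (hJ : ∀ a, J (f.toGNS a) = g.toGNS a) :
    absContPart g f = f.ofOperator (gramSupport J).starProjection := by
  have h1 := isLUB_parallelSum hJ
  have h : ∃ s, IsLUB (Set.range fun n : ℕ => parallelSum f (n • g)) s := ⟨_, h1⟩
  rw [absContPart, dif_pos h]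
  exact eq_of_le_of_le (h.choose_spec.2 h1.1) (h1.2 h.choose_spec.1)

end Supremum

/-! ### Absolute continuity and singularity as idempotence of `W = J* J`. -/

section Idempotent

variable {A : Type u} [NonUnitalRing A] [StarRing A] [Module ℂ A] [IsScalarTower ℂ A A]
  [SMulCommClass ℂ A A] [StarModule ℂ A] {f g h : RepresentableFunctional A}
  {J : f.GNS →L[ℂ] g.GNS}

lemma gram_inner_comm (J : f.GNS →L[ℂ] g.GNS) (x y : f.GNS) :
    ⟪adjoint J (J x), y⟫_ℂ = ⟪x, adjoint J (J y)⟫_ℂ := by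
  rw [adjoint_inner_left, adjoint_inner_right]

lemma norm_adjoint_comparison_le (hJ : ∀ a, J (f.toGNS a) = g.toGNS a) (hgf : g ≤ f)
    (y : g.GNS) : ‖adjoint J y‖ ≤ ‖y‖ := by
  have h1 : ‖J‖ ≤ 1 := J.opNorm_le_bound zero_le_one fun x => by
    rw [one_mul]
    exact norm_comparison_le hJ hgf x
  refine ((adjoint J).le_opNorm y).trans ?_
  rw [LinearIsometryEquiv.norm_map]
  exact mul_le_of_le_one_left (norm_nonneg _) h1

lemma norm_sub_gram_sq (J : f.GNS →L[ℂ] g.GNS) (x : f.GNS) :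
    ‖x - adjoint J (J x)‖ ^ 2 = ‖x‖ ^ 2 - 2 * ‖J x‖ ^ 2 + ‖adjoint J (J x)‖ ^ 2 := by
  rw [norm_sub_sq (𝕜 := ℂ), adjoint_inner_right, inner_self_eq_norm_sq]

/-- This is `(1 - W)² ≤ 1 - W`, which holds because `W² ≤ W`. -/
lemma norm_sub_gram_sq_le (hJ : ∀ a, J (f.toGNS a) = g.toGNS a) (hgf : g ≤ f) (x : f.GNS) :
    ‖x - adjoint J (J x)‖ ^ 2 ≤ ‖x‖ ^ 2 - ‖J x‖ ^ 2 := by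
  have := pow_le_pow_left₀ (norm_nonneg _) (norm_adjoint_comparison_le hJ hgf (J x)) 2
  rw [norm_sub_gram_sq]
  linarith

/-- Two representable functionals whose comparison operators have the same positive part agree. -/
lemma eq_of_norm_comparison_eq {J' : f.GNS →L[ℂ] h.GNS} (hJ : ∀ a, J (f.toGNS a) = g.toGNS a)
    (hJ' : ∀ a, J' (f.toGNS a) = h.toGNS a) (hn : ∀ x, ‖J x‖ = ‖J' x‖) : g = h := by
  refine eq_of_le_of_le (le_iff_norm.2 fun a => ?_) (le_iff_norm.2 fun a => ?_) <;>
  rw [← hJ, ← hJ', hn]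

lemma norm_comparison_eq_of_idempotent (hW : ∀ x, adjoint J (J (adjoint J (J x))) = adjoint J (J x))
    (x : f.GNS) : ‖J x‖ = ‖adjoint J (J x)‖ := by
  refine (sq_eq_sq₀ (norm_nonneg _) (norm_nonneg _)).1 ?_
  rw [← inner_self_eq_norm_sq (𝕜 := ℂ), ← inner_self_eq_norm_sq (𝕜 := ℂ), gram_inner_comm, hW,
    adjoint_inner_right]

lemma comparison_sub_gram_eq_zero (hW : ∀ x, adjoint J (J (adjoint J (J x))) = adjoint J (J x))
    (x : f.GNS) : J (x - adjoint J (J x)) = 0 := by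
  rw [← norm_eq_zero, norm_comparison_eq_of_idempotent hW, map_sub, map_sub, hW, sub_self,
    norm_zero]

lemma absContPart_eq_self_iff (hJ : ∀ a, J (f.toGNS a) = g.toGNS a) :
    absContPart g f = g ↔ ∀ x, adjoint J (J (adjoint J (J x))) = adjoint J (J x) := by
  rw [absContPart_eq hJ]
  constructor
  · intro h
    have hn : ∀ x, ‖(gramSupport J).starProjection x‖ = ‖J x‖ := fun x => by
      refine f.toGNS_dense.induction_on
        (p := fun x => ‖(gramSupport J).starProjection x‖ = ‖J x‖) x
        (isClosed_eq (by fun_prop) (by fun_prop)) fun a => ?_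
      rw [← norm_toGNS_ofOperator (starProjection_gramSupport_gnsRep hJ), h, hJ]
    -- On the support `J` is isometric and `J*` is a contraction, so `‖y - W y‖² = ‖W y‖² - ‖y‖² ≤
    -- 0`: `W` is the identity there.
    have hz : ∀ y, y ∈ gramSupport J → adjoint J (J y) = y := fun y hy => by
      have hJy : ‖J y‖ = ‖y‖ := by rw [← hn, Submodule.starProjection_eq_self_iff.2 hy]
      have hadj : ‖adjoint J (J y)‖ ≤ ‖y‖ := by
        have h1 : ‖J‖ ≤ 1 := J.opNorm_le_bound zero_le_one fun x => by
          rw [one_mul, ← hn]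
          exact Submodule.norm_starProjection_apply_le _ _
        refine ((adjoint J).le_opNorm _).trans ?_
        rw [LinearIsometryEquiv.norm_map, hJy]
        exact mul_le_of_le_one_left (norm_nonneg _) h1
      have h2 := norm_sub_gram_sq J y
      rw [hJy] at h2
      have h3 := pow_le_pow_left₀ (norm_nonneg _) hadj 2
      have h4 : ‖y - adjoint J (J y)‖ ^ 2 = 0 := le_antisymm (by linarith) (by positivity)
      rw [sq_eq_zero_iff, norm_eq_zero, sub_eq_zero] at h4
      exact h4.symm
    exact fun x => hz _ (gram_mem_gramSupport J x)
  · intro hW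
    have hP : ∀ x, (gramSupport J).starProjection x = adjoint J (J x) := fun x => by
      refine Submodule.eq_starProjection_of_mem_of_inner_eq_zero (gram_mem_gramSupport J x)
        fun w hw => gramSupport_induction (p := fun w => ⟪x - adjoint J (J x), w⟫_ℂ = 0)
          (isClosed_eq (by fun_prop) (by fun_prop)) (fun y => ?_) hw
      rw [adjoint_inner_right, comparison_sub_gram_eq_zero hW, inner_zero_left]
    have hn : ∀ a, ‖(f.ofOperator (gramSupport J).starProjection).toGNS a‖ = ‖g.toGNS a‖ := by
      intro a
      rw [norm_toGNS_ofOperator (starProjection_gramSupport_gnsRep hJ), hP,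
        ← norm_comparison_eq_of_idempotent hW, hJ]
    exact eq_of_le_of_le (le_iff_norm.2 fun a => by rw [hn]) (le_iff_norm.2 fun a => by rw [hn])

/-- Here `f - g` is only a linear functional, with no GNS space of its own, so its quadratic form is
expressed through those of `f` and `g`. -/
lemma functionalLE_sub_iff : FunctionalLE h.toLin (f.toLin - g.toLin) ↔
    ∀ a, ‖h.toGNS a‖ ^ 2 ≤ ‖f.toGNS a‖ ^ 2 - ‖g.toGNS a‖ ^ 2 := by
  refine forall_congr' fun a => ?_
  rw [LinearMap.sub_apply, LinearMap.sub_apply, apply_star_mul_self, apply_star_mul_self,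
    apply_star_mul_self, ← Complex.ofReal_sub, ← Complex.ofReal_sub,
    Complex.ofReal_re, Complex.ofReal_im, sub_nonneg]
  simp

lemma toLin_eq_zero_of_norm (hn : ∀ a, ‖h.toGNS a‖ = 0) : h.toLin = 0 :=
  LinearMap.ext fun a => by
    rw [← gnsVec_inner, norm_eq_zero.1 (hn a), inner_zero_right, LinearMap.zero_apply]

lemma singular_sub_iff (hJ : ∀ a, J (f.toGNS a) = g.toGNS a) (hgf : g ≤ f) :
    Singular g.toLin (f.toLin - g.toLin) ↔
      ∀ x, adjoint J (J (adjoint J (J x))) = adjoint J (J x) := by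
  constructor
  · intro hs
    -- The quadratic form of `k` is that of `(1 - W) W (1 - W)`; it lies below `W` since `1 - W` is
    -- a contraction commuting with `W`, and below `1 - W` since `J` is a contraction.
    let k : RepresentableFunctional A := ofVector g.gnsRep (J (f.gnsVec - adjoint J (J f.gnsVec)))
    have hk : ∀ a, ‖k.toGNS a‖ = ‖J (f.toGNS a - adjoint J (J (f.toGNS a)))‖ := fun a => by
      rw [norm_toGNS_ofVector, ← comparison_gnsRep hJ, map_sub, ← gram_gnsRep hJ, gnsRep_gnsVec]
    have hle : ∀ x, ‖J (x - adjoint J (J x))‖ ^ 2 ≤ ‖J x‖ ^ 2 := fun x => by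
      have h1 : J (x - adjoint J (J x)) = J x - J (adjoint J (J x)) := map_sub _ _ _
      have h2 : ‖J (adjoint J (J x))‖ ≤ ‖adjoint J (J x)‖ := norm_comparison_le hJ hgf _
      have h3 := pow_le_pow_left₀ (norm_nonneg _) h2 2
      have h4 : 0 ≤ ‖adjoint J (J x)‖ ^ 2 := by positivity
      rw [h1, norm_sub_sq (𝕜 := ℂ), ← adjoint_inner_left, inner_self_eq_norm_sq]
      linarith
    have hle' : ∀ x, ‖J (x - adjoint J (J x))‖ ^ 2 ≤ ‖x‖ ^ 2 - ‖J x‖ ^ 2 := fun x =>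
      (pow_le_pow_left₀ (norm_nonneg _) (norm_comparison_le hJ hgf _) 2).trans
        (norm_sub_gram_sq_le hJ hgf x)
    have h0 : k.toLin = 0 := hs k
      (show k ≤ g from le_iff_norm.2 fun a => by
        rw [hk, ← hJ]
        exact hle _)
      (functionalLE_sub_iff.2 fun a => by
        rw [hk, ← hJ]
        exact hle' _)
    have h1 : ∀ x, J (x - adjoint J (J x)) = 0 := fun x => by
      refine f.toGNS_dense.induction_on (p := fun x => J (x - adjoint J (J x)) = 0) x
        (isClosed_eq (by fun_prop) (by fun_prop)) fun a => ?_
      have h2 := apply_star_mul_self k a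
      rw [h0, LinearMap.zero_apply, hk] at h2
      have h3 : ‖J (f.toGNS a - adjoint J (J (f.toGNS a)))‖ ^ 2 = 0 := by exact_mod_cast h2.symm
      exact norm_eq_zero.1 (sq_eq_zero_iff.1 h3)
    intro x
    have h2 := congrArg (adjoint J) (h1 x)
    rw [map_sub, map_sub, map_zero, sub_eq_zero] at h2
    exact h2.symm
  · intro hW k hkg hkf
    have hkg' : k ≤ g := hkg
    obtain ⟨K, hK⟩ := exists_comparison_of_le (hkg'.trans hgf)
    have h1 : ∀ x, ‖K x‖ ^ 2 ≤ ‖J x‖ ^ 2 := fun x => by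
      refine f.toGNS_dense.induction_on (p := fun x => ‖K x‖ ^ 2 ≤ ‖J x‖ ^ 2) x
        (isClosed_le (by fun_prop) (by fun_prop)) fun a => ?_
      rw [hK, hJ]
      exact le_iff_norm.1 hkg' a
    have h2 : ∀ x, ‖K x‖ ^ 2 ≤ ‖x‖ ^ 2 - ‖J x‖ ^ 2 := fun x => by
      refine f.toGNS_dense.induction_on (p := fun x => ‖K x‖ ^ 2 ≤ ‖x‖ ^ 2 - ‖J x‖ ^ 2) x
        (isClosed_le (by fun_prop) (by fun_prop)) fun a => ?_
      rw [hK, hJ]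
      exact functionalLE_sub_iff.1 hkf a
    refine toLin_eq_zero_of_norm fun a => ?_
    set x := f.toGNS a
    -- Being below `W`, `K` kills the range of `1 - W`; being below `1 - W`, it kills the range of
    -- `W`. These two ranges span.
    have h3 : K (x - adjoint J (J x)) = 0 := by
      have h := h1 (x - adjoint J (J x))
      rw [comparison_sub_gram_eq_zero hW] at h
      simpa using h
    have h4 : K (adjoint J (J x)) = 0 := by
      have h := h2 (adjoint J (J x))
      rw [norm_comparison_eq_of_idempotent hW (adjoint J (J x)), hW, sub_self] at h
      simpa using h
    rw [← hK, ← sub_add_cancel (f.toGNS a) (adjoint J (J (f.toGNS a))), map_add, h3, h4]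
    simp

end Idempotent
-- Extreme points of the interval as idempotence of `W`.
section Extreme

variable {A : Type u} [NonUnitalRing A] [StarRing A] [Module ℂ A] [IsScalarTower ℂ A A]
  [SMulCommClass ℂ A A] [StarModule ℂ A] {f g h k : RepresentableFunctional A}
  {J : f.GNS →L[ℂ] g.GNS}

lemma norm_toGNS_sq_of_combination {s t : ℝ}
    (hst : s • h.toLin + t • k.toLin = g.toLin) (a : A) :
    s * ‖h.toGNS a‖ ^ 2 + t * ‖k.toGNS a‖ ^ 2 = ‖g.toGNS a‖ ^ 2 := by
  have h1 := congrArg (fun φ : A →ₗ[ℂ] ℂ => φ (star a * a)) hst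
  simp only [LinearMap.add_apply, LinearMap.smul_apply, apply_star_mul_self,
    Complex.real_smul] at h1
  exact_mod_cast h1

/-- If the projection `W` is a proper convex combination of `H* H` and `K* K`, both between `0` and
`1`, then both vanish on `ker W` and both attain the bound `1` on the range of `W`. -/
lemma eq_of_combination (hJ : ∀ a, J (f.toGNS a) = g.toGNS a)
    (hW : ∀ x, adjoint J (J (adjoint J (J x))) = adjoint J (J x)) (hhf : h ≤ f) (hkf : k ≤ f)
    {s t : ℝ} (hs : 0 < s) (ht : 0 < t) (hst1 : s + t = 1)
    (hst : s • h.toLin + t • k.toLin = g.toLin) : h = g := by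
  obtain ⟨H, hH⟩ := exists_comparison_of_le hhf
  obtain ⟨K, hK⟩ := exists_comparison_of_le hkf
  have hn : ∀ x, s * ‖H x‖ ^ 2 + t * ‖K x‖ ^ 2 = ‖J x‖ ^ 2 := fun x => by
    refine f.toGNS_dense.induction_on
      (p := fun x => s * ‖H x‖ ^ 2 + t * ‖K x‖ ^ 2 = ‖J x‖ ^ 2) x
      (isClosed_eq (by fun_prop) (by fun_prop)) fun a => ?_
    rw [hH, hK, hJ]
    exact norm_toGNS_sq_of_combination hst a
  have h0 : ∀ x, H (x - adjoint J (J x)) = 0 := fun x => by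
    have h1 := hn (x - adjoint J (J x))
    rw [comparison_sub_gram_eq_zero hW, norm_zero] at h1
    have h2 : 0 ≤ t * ‖K (x - adjoint J (J x))‖ ^ 2 := by positivity
    have h3 : 0 ≤ s * ‖H (x - adjoint J (J x))‖ ^ 2 := by positivity
    have h4 : s * ‖H (x - adjoint J (J x))‖ ^ 2 = 0 := by linarith
    simpa [hs.ne'] using h4
  have h1 : ∀ x, ‖H (adjoint J (J x))‖ ^ 2 = ‖adjoint J (J x)‖ ^ 2 := fun x => by
    have h2 := hn (adjoint J (J x))
    rw [norm_comparison_eq_of_idempotent hW (adjoint J (J x)), hW] at h2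
    have h3 := pow_le_pow_left₀ (norm_nonneg _) (norm_comparison_le hH hhf (adjoint J (J x))) 2
    have h4 := pow_le_pow_left₀ (norm_nonneg _) (norm_comparison_le hK hkf (adjoint J (J x))) 2
    refine le_antisymm h3 ?_
    -- The average of two numbers at most `‖W x‖²` equals `‖W x‖²`, so neither can be smaller.
    obtain rfl : t = 1 - s := by linarith
    have h5 := mul_le_mul_of_nonneg_left h4 ht.le
    exact le_of_mul_le_mul_left (by linarith) hs
  refine eq_of_norm_comparison_eq hH hJ fun x => ?_
  rw [norm_comparison_eq_of_idempotent hW, ← sub_add_cancel x (adjoint J (J x)), map_add H, h0,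
    zero_add, sub_add_cancel]
  exact (sq_eq_sq₀ (norm_nonneg _) (norm_nonneg _)).1 (h1 x)

/-- The operator `2 W - W²`, where `W = J* J`. -/
noncomputable def gramComplement (J : f.GNS →L[ℂ] g.GNS) : f.GNS →L[ℂ] f.GNS :=
  (2 : ℂ) • (adjoint J ∘L J) - (adjoint J ∘L J) ∘L (adjoint J ∘L J)

lemma gramComplement_apply (J : f.GNS →L[ℂ] g.GNS) (x : f.GNS) :
    gramComplement J x = (2 : ℂ) • adjoint J (J x) - adjoint J (J (adjoint J (J x))) := rfl

lemma inner_gramComplement (J : f.GNS →L[ℂ] g.GNS) (x : f.GNS) :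
    ⟪x, gramComplement J x⟫_ℂ = ((2 * ‖J x‖ ^ 2 - ‖adjoint J (J x)‖ ^ 2 : ℝ) : ℂ) := by
  rw [gramComplement_apply, inner_sub_right, inner_smul_right,
    ← gram_inner_comm J x (adjoint J (J x)), adjoint_inner_right, inner_self_eq_norm_sq_to_K,
    inner_self_eq_norm_sq_to_K]
  push_cast
  rfl

lemma isPositive_gramComplement (hJ : ∀ a, J (f.toGNS a) = g.toGNS a) (hgf : g ≤ f) :
    (gramComplement J).IsPositive := by
  rw [ContinuousLinearMap.isPositive_iff_complex]
  intro x
  rw [← inner_conj_symm, inner_gramComplement, Complex.conj_ofReal]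
  refine ⟨rfl, ?_⟩
  have := pow_le_pow_left₀ (norm_nonneg _) (norm_adjoint_comparison_le hJ hgf (J x)) 2
  have h2 : 0 ≤ ‖J x‖ ^ 2 := by positivity
  change 0 ≤ 2 * ‖J x‖ ^ 2 - ‖adjoint J (J x)‖ ^ 2
  linarith

lemma gramComplement_gnsRep (hJ : ∀ a, J (f.toGNS a) = g.toGNS a) (a : A) (x : f.GNS) :
    gramComplement J (f.gnsRep a x) = f.gnsRep a (gramComplement J x) := by
  simp only [gramComplement_apply, gram_gnsRep hJ, map_sub, map_smul]

lemma exists_sqrt_gramComplement (hJ : ∀ a, J (f.toGNS a) = g.toGNS a) (hgf : g ≤ f) :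
    ∃ S : f.GNS →L[ℂ] f.GNS, (∀ a x, S (f.gnsRep a x) = f.gnsRep a (S x)) ∧
      ∀ x, adjoint S (S x) = gramComplement J x :=
  ⟨CFC.sqrt (gramComplement J), sqrt_commute_gnsRep (gramComplement_gnsRep hJ),
    adjoint_sqrt_sqrt_apply (isPositive_gramComplement hJ hgf)⟩

lemma half_add_half_gramComplement (hJ : ∀ a, J (f.toGNS a) = g.toGNS a)
    {R S : f.GNS →L[ℂ] f.GNS} (hR : ∀ x, R x = adjoint J (J x))
    (hg : ∀ a x, R (f.gnsRep a x) = f.gnsRep a (R x)) (hc : ∀ a x, S (f.gnsRep a x) = f.gnsRep a (S x))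
    (hS : ∀ x, adjoint S (S x) = gramComplement J x) :
    (1 / 2 : ℝ) • (f.ofOperator R).toLin +
      (1 / 2 : ℝ) • (f.ofOperator S).toLin = g.toLin := LinearMap.ext fun a => by
  have h1 : (f.ofOperator R).toLin a =
      ⟪f.gnsVec, adjoint J (J (adjoint J (J (f.toGNS a))))⟫_ℂ := by
    rw [ofOperator_apply hg, hR, hR, gram_inner_comm]
  have h2 : (f.ofOperator S).toLin a = 2 * ⟪f.gnsVec, adjoint J (J (f.toGNS a))⟫_ℂ -
      ⟪f.gnsVec, adjoint J (J (adjoint J (J (f.toGNS a))))⟫_ℂ := by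
    rw [ofOperator_apply hc, ← adjoint_inner_right S, hS, gramComplement_apply, inner_sub_right,
      inner_smul_right]
  rw [LinearMap.add_apply, LinearMap.smul_apply, LinearMap.smul_apply, h1, h2,
    toLin_eq_inner_gram hJ, Complex.real_smul, Complex.real_smul]
  push_cast
  ring

/-- With `R = W` and `S = (2W - W²)^{1/2}`, the functionals of `R` and `S` correspond to `W²` and
`2W - W²`, whose midpoint is `W`. Extremality identifies the first with `g`, that is, `W² = W`. -/
lemma gram_idempotent_of_mem_extremePoints (hJ : ∀ a, J (f.toGNS a) = g.toGNS a) (hgf : g ≤ f)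
    (he : g.toLin ∈ Set.extremePoints ℝ (interval 0 f)) (x : f.GNS) :
    adjoint J (J (adjoint J (J x))) = adjoint J (J x) := by
  obtain ⟨S, hc, hS⟩ := exists_sqrt_gramComplement hJ hgf
  obtain ⟨R, hR⟩ : ∃ R : f.GNS →L[ℂ] f.GNS, ∀ x, R x = adjoint J (J x) :=
    ⟨adjoint J ∘L J, fun _ => rfl⟩
  have hg : ∀ a x, R (f.gnsRep a x) = f.gnsRep a (R x) := fun a x => by
    rw [hR, hR, gram_gnsRep hJ]
  have hSn : ∀ x, ‖S x‖ ^ 2 = 2 * ‖J x‖ ^ 2 - ‖adjoint J (J x)‖ ^ 2 := fun x => by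
    have h1 : ((‖S x‖ ^ 2 : ℝ) : ℂ) = ⟪S x, S x⟫_ℂ := by
      rw [inner_self_eq_norm_sq_to_K]
      norm_cast
    rw [← adjoint_inner_right, hS, inner_gramComplement] at h1
    exact_mod_cast h1
  have h₁ : f.ofOperator R ≤ f := le_iff_norm.2 fun a => by
    rw [norm_toGNS_ofOperator hg, hR]
    exact pow_le_pow_left₀ (norm_nonneg _) ((norm_adjoint_comparison_le hJ hgf _).trans
      (norm_comparison_le hJ hgf _)) 2
  have h₂ : f.ofOperator S ≤ f := le_iff_norm.2 fun a => by
    rw [norm_toGNS_ofOperator hc, hSn]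
    -- This gives `‖S a‖² = ‖a‖² - ‖a - W a‖²`.
    have h3 := norm_sub_gram_sq J (f.toGNS a)
    have h4 : 0 ≤ ‖f.toGNS a - adjoint J (J (f.toGNS a))‖ ^ 2 := by positivity
    linarith
  have heq : (f.ofOperator R).toLin = g.toLin :=
    (mem_extremePoints.1 he).2 _ ⟨_, ⟨zero_le _, h₁⟩, rfl⟩ _ ⟨_, ⟨zero_le _, h₂⟩, rfl⟩
      ⟨1 / 2, 1 / 2, by norm_num, by norm_num, by norm_num,
        half_add_half_gramComplement hJ hR hg hc hS⟩ |>.1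
  have hn : ∀ x, ‖adjoint J (J x)‖ ^ 2 = ‖J x‖ ^ 2 := fun x => by
    refine f.toGNS_dense.induction_on (p := fun x => ‖adjoint J (J x)‖ ^ 2 = ‖J x‖ ^ 2) x
      (isClosed_eq (by fun_prop) (by fun_prop)) fun a => ?_
    have h3 := apply_star_mul_self (f.ofOperator R) a
    rw [heq, apply_star_mul_self, norm_toGNS_ofOperator hg, hR, ← hJ] at h3
    exact_mod_cast h3.symm
  have h0 : J (x - adjoint J (J x)) = 0 := by
    have h1 : J (x - adjoint J (J x)) = J x - J (adjoint J (J x)) := map_sub _ _ _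
    have h3 := pow_le_pow_left₀ (norm_nonneg _) (norm_comparison_le hJ hgf (adjoint J (J x))) 2
    -- The expansion is `‖J x‖² - 2 ‖W x‖² + ‖J W x‖²`; the first term equals `‖W x‖²` and the last
    -- is at most that.
    have h4 : ‖J (x - adjoint J (J x))‖ ^ 2 ≤ 0 := by
      rw [h1, norm_sub_sq (𝕜 := ℂ), ← adjoint_inner_left, inner_self_eq_norm_sq]
      linarith [hn x]
    exact norm_eq_zero.1 (sq_eq_zero_iff.1 (le_antisymm h4 (by positivity)))
  have h2 := congrArg (adjoint J) h0
  rw [map_sub, map_sub, map_zero, sub_eq_zero] at h2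
  exact h2.symm

lemma mem_extremePoints_interval_iff (hJ : ∀ a, J (f.toGNS a) = g.toGNS a) (hgf : g ≤ f) :
    g.toLin ∈ Set.extremePoints ℝ (interval 0 f) ↔
      ∀ x, adjoint J (J (adjoint J (J x))) = adjoint J (J x) := by
  refine ⟨gram_idempotent_of_mem_extremePoints hJ hgf, fun hW => mem_extremePoints_iff_left.2
    ⟨⟨g, ⟨zero_le _, hgf⟩, rfl⟩, ?_⟩⟩
  rintro _ ⟨h, ⟨-, hhf⟩, rfl⟩ _ ⟨k, ⟨-, hkf⟩, rfl⟩ ⟨s, t, hs, ht, hst1, hst⟩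
  rw [eq_of_combination hJ hW hhf hkf hs ht hst1 hst]

end Extreme
end RepresentableFunctional

theorem theoremT {A : Type u} [NonUnitalRing A] [StarRing A] [Module ℂ A] [IsScalarTower ℂ A A]
    [SMulCommClass ℂ A A] [StarModule ℂ A] (f g : RepresentableFunctional A) (hgf : g ≤ f) :
    IsLUB (Set.range fun n : ℕ => RepresentableFunctional.parallelSum f (n • g))
        (RepresentableFunctional.absContPart g f) ∧
      List.TFAE [
        g.toLin ∈ Set.extremePoints ℝ (RepresentableFunctional.interval 0 f),
        RepresentableFunctional.IsDisjointPart g f,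
        RepresentableFunctional.absContPart g f = g] := by
  obtain ⟨J, hJ⟩ := RepresentableFunctional.exists_comparison_of_le hgf
  constructor
  · rw [RepresentableFunctional.absContPart_eq hJ]
    exact RepresentableFunctional.isLUB_parallelSum hJ
  · tfae_have 1 ↔ 3 := by
      rw [RepresentableFunctional.mem_extremePoints_interval_iff hJ hgf,
        RepresentableFunctional.absContPart_eq_self_iff hJ]
    tfae_have 2 ↔ 3 := by
      rw [RepresentableFunctional.IsDisjointPart, and_iff_right hgf,
        RepresentableFunctional.singular_sub_iff hJ hgf,
        RepresentableFunctional.absContPart_eq_self_iff hJ]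
    tfae_finish
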